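/- For $n, m \in \mathbb{N}$, let $S(n,m)$ be the (generalized and extended) Sierpinski graph in the Klavžar–Milutinović representation: its vertex set is $\{0,1,\dots,m-1\}^n$, and two vertices $u,v$ are adjacent if and only if there is $h \in \{1,\dots,n\}$ such that $u_i = v_i$ for $1 \le i < h$, $u_h \ne v_h$, and $u_j = v_h$ and $v_j = u_h$ for $h < j \le n$. For a set $S$ of vertices of a finite graph $G$, let $\Theta(S)$ denote its edge-boundary, i.e. the set of edges of $G$ with exactly one end in $S$, and for $0 \le \ell \le |V(G)|$ let $|\Theta|(G;\ell) = \min\{|\Theta(S)| : S \subseteq V(G),\ |S| = \ell\}$. For $0 \le \ell \le m^n$ let $L_\ell$ be the initial $\ell$-segment of the lexicographic order on $\{0,1,\dots,m-1\}^n$, i.e. the set of the tuples in positions $1,\dots,\ell$ of this order. Then for all $n, m$ and all $0 \le \ell \le m^n$ one has $|L_\ell| = \ell$ and $$|\Theta|(S(n,m);\ell) = |\Theta(L_\ell)|,$$ and $L_\ell \subseteq L_{\ell'}$ whenever $\ell \le \ell' \le m^n$. That is, the initial segments of the lexicographic order are nested solutions of the edge-isoperimetric problem on $S(n,m)$. 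-/

import Mathlib

/-- The (generalized and extended) Sierpinski graph `S(n,m)` in the Klavžar–Milutinović
representation: the vertices are the `n`-tuples over `{0, …, m-1}`. -/
def sierpinskiGraph (n m : ℕ) : SimpleGraph (Fin n → Fin m) where
  Adj u v := ∃ h : Fin n,
    (∀ i, i < h → u i = v i) ∧ u h ≠ v h ∧ (∀ j, h < j → u j = v h ∧ v j = u h)
  symm := ⟨by
    rintro u v ⟨h, h1, h2, h3⟩
    exact ⟨h, fun i hi => (h1 i hi).symm, h2.symm, fun j hj => (h3 j hj).symm⟩⟩
  loopless := ⟨by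
    rintro u ⟨h, -, h2, -⟩
    exact h2 rfl⟩

/-- The edge-boundary `Θ(S)`: the edges with one end in `S` and the other end outside `S`. -/
def edgeBoundary {V : Type*} (G : SimpleGraph V) (S : Finset V) : Set (Sym2 V) :=
  {e | e ∈ G.edgeSet ∧ ∃ v w, e = s(v, w) ∧ v ∈ S ∧ w ∉ S}

/-- The edge-isoperimetric profile `|Θ|(G; ℓ)` of a finite graph: the minimum of `|Θ(S)|` over
the sets `S` of `ℓ` vertices (a minimum of a nonempty set for `ℓ ≤ |V|`). -/
noncomputable def edgeProfile {V : Type*} (G : SimpleGraph V) (ℓ : ℕ) : ℕ :=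
  sInf {k | ∃ S : Finset V, S.card = ℓ ∧ (edgeBoundary G S).ncard = k}

/-- The position, counted from `1`, of the tuple `v` in the lexicographic order on
`{0, …, m-1}^n` (the first coordinate is the most significant one). -/
noncomputable def lexPosition {n m : ℕ} (v : Fin n → Fin m) : ℕ :=
  (Finset.univ.filter fun u : Fin n → Fin m => toLex u ≤ toLex v).card

/-- The initial `ℓ`-segment of the lexicographic order: the vertices in positions `1, …, ℓ`. -/
noncomputable def lexInitial (n m ℓ : ℕ) : Finset (Fin n → Fin m) :=
  Finset.univ.filter fun v => lexPosition v ≤ ℓ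

/-!
The proof counts inner edges instead of boundary edges. If each of the `m` corners `(c, …, c)` of
`S(n,m)` is given a pendant edge, then every vertex has degree `m` (`degree_add_corners`), so
`|Θ(S)| + 2 e(S) + k(S) = m |S|`, where `e(S)` is the number of edges spanned by `S` and `k(S)` the
number of corners in `S` (`ncard_edgeBoundary_add`). It suffices that initial segments maximise both
`e(S)` and `e(S) + k(S)`.

Both are cases of `adjPairs_add_corners_le`: for *every* set `T` of corners, the number of edges
spanned by `S` plus the number of corners of `T` in `S` is at most `E(|S|) + min |T| q(|S|)`, where
`E(x)` (`lexEdges`) and `q(x)` (`lexCorners`) are the numbers of edges and corners of the initial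
segment of size `x`. The general `T` makes an induction on `n` possible. The graph `S(n+1,m)`
consists of `m` copies of `S(n,m)`, any two of them joined by one edge between corners. List the
copies by decreasing number of vertices of `S`, and charge the edge between two copies to its end in
the later one. The `j`-th copy then carries pendant edges at `j` of its corners, and at one more if
its own corner belongs to `T`, so the induction hypothesis applies to it.

What remains is an inequality between values of `E` and `q` (`sum_lexEdges_sort_le`): filling the
copies one after the other is best. It follows by repeatedly moving vertices from the last nonempty
copy to the first copy that is not full (`sum_lexEdges_le`). Each move is justified by the exchange
inequality `lexEdges_exchange`, that is, `E(x) + E(y) + q(y) ≤ E(x + y)` for `y ≤ x` and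
`x + y ≤ m ^ n`, together with a variant for `m ^ n ≤ x + y`; it is proved by induction on `n`
from the recursions for `E` and `q`.
-/

/-! ### The number of edges and corners of an initial segment -/

/-- The number of corners `(i, …, i)` among the first `x` vertices of `S(n,m)` in lexicographic
order (`lexCorners_spec`). Writing `x = a * m ^ n + r`, the corners of the first `a` copies of
`S(n,m)` in `S(n+1,m)` are counted, and that of the next copy if the first `r` vertices of that
copy reach it. For `n = 0` the single vertex counts as `m` corners. -/
def lexCorners (m : ℕ) : ℕ → ℕ → ℕ
  | 0, x => if x = 0 then 0 else m
  | n + 1, x => x / m ^ n + if x / m ^ n < lexCorners m n (x % m ^ n) then 1 else 0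

/-- The number of edges spanned by the first `x` vertices of `S(n,m)` in lexicographic order
(`adjPairs_lexInitial`). Writing `x = a * m ^ n + r`, the `a` full copies of `S(n,m)` are pairwise
joined by an edge, and each corner `i < a` of the partial copy is joined to the `i`-th copy. -/
def lexEdges (m : ℕ) : ℕ → ℕ → ℕ
  | 0, _ => 0
  | n + 1, x => x / m ^ n * lexEdges m n (m ^ n) + (x / m ^ n).choose 2 +
      lexEdges m n (x % m ^ n) + min (x / m ^ n) (lexCorners m n (x % m ^ n))

theorem lexCorners_zero (m n : ℕ) : lexCorners m n 0 = 0 := by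
  induction n with
  | zero => simp [lexCorners]
  | succ n ih => simp [lexCorners, ih]

theorem lexEdges_zero (m n : ℕ) : lexEdges m n 0 = 0 := by
  induction n with
  | zero => simp [lexEdges]
  | succ n ih => simp [lexEdges, ih]

theorem lexCorners_pos {m : ℕ} (hm : 0 < m) (n : ℕ) {x : ℕ} (hx : 0 < x) :
    0 < lexCorners m n x := by
  induction n generalizing x with
  | zero => simp [lexCorners, hx.ne', hm]
  | succ n ih =>
    rw [lexCorners]
    rcases Nat.eq_zero_or_pos (x / m ^ n) with h | h
    · have h1 : 0 < x % m ^ n := by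
        have := Nat.div_add_mod x (m ^ n)
        rw [h] at this
        omega
      simp [h, ih h1]
    · omega

theorem lexCorners_mono {m : ℕ} (hm : 0 < m) (n : ℕ) : Monotone (lexCorners m n) := by
  induction n with
  | zero =>
    intro x y h
    simp only [lexCorners]
    split_ifs <;> omega
  | succ n ih =>
    intro x y h
    have hM : 0 < m ^ n := Nat.pow_pos hm
    have h1 : x / m ^ n ≤ y / m ^ n := Nat.div_le_div_right h
    simp only [lexCorners]
    rcases h1.lt_or_eq with h2 | h2
    · split_ifs <;> omega
    · have h3 : x % m ^ n ≤ y % m ^ n := by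
        have hx := Nat.div_add_mod x (m ^ n)
        have hy := Nat.div_add_mod y (m ^ n)
        rw [h2] at hx
        omega
      have := ih h3
      rw [h2]
      split_ifs <;> omega

theorem lexCorners_pow {m : ℕ} (hm : 0 < m) (n : ℕ) : lexCorners m n (m ^ n) = m := by
  cases n with
  | zero => simp [lexCorners]
  | succ n =>
    have hM : 0 < m ^ n := Nat.pow_pos hm
    rw [lexCorners, pow_succ', Nat.mul_div_cancel _ hM, Nat.mul_mod_left, lexCorners_zero]
    simp

/-- The last corner is the last vertex, so a proper initial segment misses it. -/
theorem lexCorners_lt {m : ℕ} (hm : 0 < m) (n : ℕ) {x : ℕ} (hx : x < m ^ n) :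
    lexCorners m n x < m := by
  induction n generalizing x with
  | zero =>
    have : x = 0 := by simpa using hx
    simpa [lexCorners, this] using hm
  | succ n ih =>
    have hM : 0 < m ^ n := Nat.pow_pos hm
    have h1 : x / m ^ n < m := Nat.div_lt_of_lt_mul (by rwa [pow_succ] at hx)
    have h2 := ih (Nat.mod_lt x hM)
    rw [lexCorners]
    split_ifs <;> omega

theorem choose_two_add (a b : ℕ) : (a + b).choose 2 = a.choose 2 + b.choose 2 + a * b := by
  induction b with
  | zero => simp
  | succ b ih =>
    have h1 := Nat.choose_succ_succ (a + b) 1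
    have h2 := Nat.choose_succ_succ b 1
    simp only [Nat.choose_one_right, Nat.succ_eq_add_one, Nat.reduceAdd] at h1 h2
    rw [← add_assoc, mul_add]
    omega

theorem lexCorners_succ_add {m : ℕ} (hm : 0 < m) (n : ℕ) {a r : ℕ} (ha : a < m) (hr : r ≤ m ^ n) :
    lexCorners m (n + 1) (a * m ^ n + r) = a + if a < lexCorners m n r then 1 else 0 := by
  have hM : 0 < m ^ n := Nat.pow_pos hm
  rcases hr.lt_or_eq with h | h
  · have h1 : (a * m ^ n + r) / m ^ n = a := by
      rw [add_comm, Nat.add_mul_div_right _ _ hM, Nat.div_eq_of_lt h, zero_add]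
    have h2 : (a * m ^ n + r) % m ^ n = r := by
      rw [add_comm, Nat.add_mul_mod_self_right, Nat.mod_eq_of_lt h]
    rw [lexCorners, h1, h2]
  · subst h
    have h0 : a * m ^ n + m ^ n = (a + 1) * m ^ n := by ring
    rw [h0, lexCorners, Nat.mul_div_cancel _ hM, Nat.mul_mod_left, lexCorners_zero,
      lexCorners_pow hm]
    simp [ha]

theorem lexEdges_succ_add {m : ℕ} (hm : 0 < m) (n : ℕ) {a r : ℕ} (ha : a < m) (hr : r ≤ m ^ n) :
    lexEdges m (n + 1) (a * m ^ n + r) =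
      a * lexEdges m n (m ^ n) + a.choose 2 + lexEdges m n r + min a (lexCorners m n r) := by
  have hM : 0 < m ^ n := Nat.pow_pos hm
  rcases hr.lt_or_eq with h | h
  · have h1 : (a * m ^ n + r) / m ^ n = a := by
      rw [add_comm, Nat.add_mul_div_right _ _ hM, Nat.div_eq_of_lt h, zero_add]
    have h2 : (a * m ^ n + r) % m ^ n = r := by
      rw [add_comm, Nat.add_mul_mod_self_right, Nat.mod_eq_of_lt h]
    rw [lexEdges, h1, h2]
  · subst h
    have h0 : a * m ^ n + m ^ n = (a + 1) * m ^ n := by ring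
    rw [h0, lexEdges, Nat.mul_div_cancel _ hM, Nat.mul_mod_left, lexCorners_zero,
      lexCorners_pow hm, lexEdges_zero, choose_two_add, min_eq_left ha.le]
    simp
    ring

theorem lexEdges_succ_mul {m : ℕ} (hm : 0 < m) (n a : ℕ) :
    lexEdges m (n + 1) (a * m ^ n) = a * lexEdges m n (m ^ n) + a.choose 2 := by
  have hM : 0 < m ^ n := Nat.pow_pos hm
  rw [lexEdges, Nat.mul_div_cancel _ hM, Nat.mul_mod_left, lexCorners_zero, lexEdges_zero]
  simp

theorem lexCorners_succ_mul {m : ℕ} (hm : 0 < m) (n a : ℕ) :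
    lexCorners m (n + 1) (a * m ^ n) = a := by
  have hM : 0 < m ^ n := Nat.pow_pos hm
  rw [lexCorners, Nat.mul_div_cancel _ hM, Nat.mul_mod_left, lexCorners_zero]
  simp

/-- The exchange inequality: moving vertices from the smaller of two partial initial segments to
the larger one, until the larger one is full or the smaller one is empty, loses no edges, even if
every corner in the smaller segment, and no corner in the larger one, counts as an additional
edge. -/
theorem lexEdges_exchange {m : ℕ} (hm : 0 < m) (n : ℕ) {x y : ℕ} (hyx : y ≤ x) (hx : x < m ^ n) :
    (x + y ≤ m ^ n →
      lexEdges m n x + lexEdges m n y + lexCorners m n y ≤ lexEdges m n (x + y)) ∧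
    (m ^ n ≤ x + y →
      lexEdges m n x + lexEdges m n y + lexCorners m n y ≤
        lexEdges m n (m ^ n) + lexEdges m n (x + y - m ^ n) + lexCorners m n (x + y - m ^ n)) := by
  induction n generalizing x y with
  | zero =>
    have h1 : x = 0 := by simpa using hx
    have h2 : y = 0 := by omega
    subst h1 h2
    simp [lexEdges, lexCorners]
  | succ n ih =>
    have hM : 0 < m ^ n := Nat.pow_pos hm
    obtain ⟨a, r, ha, hr, rfl⟩ : ∃ a r, a < m ∧ r < m ^ n ∧ x = a * m ^ n + r :=
      ⟨x / m ^ n, x % m ^ n, Nat.div_lt_of_lt_mul (by rwa [pow_succ] at hx),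
        Nat.mod_lt _ hM, (Nat.div_add_mod' _ _).symm⟩
    obtain ⟨b, s, hb, hs, rfl⟩ : ∃ b s, b < m ∧ s < m ^ n ∧ y = b * m ^ n + s :=
      ⟨y / m ^ n, y % m ^ n, Nat.div_lt_of_lt_mul (by rw [pow_succ] at hx; omega),
        Nat.mod_lt _ hM, (Nat.div_add_mod' _ _).symm⟩
    have hab : b < a ∨ (b = a ∧ s ≤ r) := by
      rcases lt_trichotomy a b with h | h | h
      · exfalso
        have : (a + 1) * m ^ n ≤ b * m ^ n := Nat.mul_le_mul_right _ h
        rw [add_mul] at this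
        omega
      · subst h
        right
        omega
      · exact Or.inl h
    -- The remainders need not be ordered like `x` and `y`, so the smaller one gains its corners.
    have ih' : ((r + s ≤ m ^ n → lexEdges m n r + lexEdges m n s +
          min (lexCorners m n r) (lexCorners m n s) ≤ lexEdges m n (r + s)) ∧
        (m ^ n ≤ r + s → lexEdges m n r + lexEdges m n s +
          min (lexCorners m n r) (lexCorners m n s) ≤ lexEdges m n (m ^ n) +
            lexEdges m n (r + s - m ^ n) + lexCorners m n (r + s - m ^ n))) := by
      rcases le_total s r with h | h
      · rw [min_eq_right (lexCorners_mono hm n h)]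
        exact ih h hr
      · rw [min_eq_left (lexCorners_mono hm n h), add_comm r s,
          add_comm (lexEdges m n r) (lexEdges m n s)]
        exact ih h hs
    rw [lexEdges_succ_add hm n ha hr.le, lexEdges_succ_add hm n hb hs.le,
      lexCorners_succ_add hm n hb hs.le]
    have qr := lexCorners_lt hm n hr
    have qs := lexCorners_lt hm n hs
    have qr0 : r = 0 ∨ 0 < lexCorners m n r := by
      rcases Nat.eq_zero_or_pos r with h | h
      · exact Or.inl h
      · exact Or.inr (lexCorners_pos hm n h)
    have qsr : s ≤ r → lexCorners m n s ≤ lexCorners m n r := fun h => lexCorners_mono hm n h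
    have qrs : r ≤ s → lexCorners m n r ≤ lexCorners m n s := fun h => lexCorners_mono hm n h
    rcases lt_or_ge (r + s) (m ^ n) with hc | hc
    · have ih1 := ih'.1 hc.le
      have q1 : lexCorners m n r ≤ lexCorners m n (r + s) := lexCorners_mono hm n (by omega)
      have q2 : lexCorners m n s ≤ lexCorners m n (r + s) := lexCorners_mono hm n (by omega)
      constructor
      · intro h
        -- `x + y` fills `a + b` copies, and only if `r = s = 0` can these be all.
        rcases eq_or_ne (a + b) m with he | he
        · have h0 : r + s = 0 := by
            have : m ^ (n + 1) = a * m ^ n + b * m ^ n := by rw [← add_mul, he, pow_succ']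
            omega
          have hr0 : r = 0 := by omega
          have hs0 : s = 0 := by omega
          subst hr0 hs0
          have e1 : a * m ^ n + 0 + (b * m ^ n + 0) = (a + b) * m ^ n := by ring
          have e2 : b ≤ a * b := Nat.le_mul_of_pos_left b (by omega)
          rw [e1, lexEdges_succ_mul hm, choose_two_add, lexCorners_zero, lexEdges_zero, add_mul]
          simp
          omega
        · have he' : a + b < m := by
            have : a + b < m + 1 := by
              by_contra hcon
              have h2 : (m + 1) * m ^ n ≤ (a + b) * m ^ n := Nat.mul_le_mul_right _ (by omega)
              have h3 : (m + 1) * m ^ n = m ^ (n + 1) + m ^ n := by ring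
              rw [h3, add_mul] at h2
              omega
            omega
          have e1 : a * m ^ n + r + (b * m ^ n + s) = (a + b) * m ^ n + (r + s) := by ring
          rw [e1, lexEdges_succ_add hm n he' hc.le, choose_two_add, add_mul]
          rcases Nat.eq_zero_or_pos a with ha0 | ha0
          · have hb0 : b = 0 := by omega
            subst ha0 hb0
            split_ifs <;> simp <;> omega
          · have e2 : b ≤ a * b := Nat.le_mul_of_pos_left b ha0
            split_ifs <;> omega
      · intro h
        -- `x + y` exceeds `m ^ (n + 1)` by `c` full copies and `r + s` vertices, and the gain in
        -- edges between full copies is `u * v`.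
        have he : m ≤ a + b := by
          by_contra hcon
          have h2 : (a + b + 1) * m ^ n ≤ m * m ^ n := Nat.mul_le_mul_right _ (by omega)
          rw [← pow_succ', add_mul, add_mul] at h2
          omega
        obtain ⟨c, hcm⟩ := Nat.exists_eq_add_of_le he
        obtain ⟨u, hu⟩ := Nat.exists_eq_add_of_le ha.le
        obtain ⟨v, hv⟩ := Nat.exists_eq_add_of_le hb.le
        have hbc : b = c + u := by omega
        have hac : a = c + v := by omega
        have e1 : a * m ^ n + r + (b * m ^ n + s) - m ^ (n + 1) = c * m ^ n + (r + s) := by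
          have : (a + b) * m ^ n = (m + c) * m ^ n := by rw [hcm]
          rw [add_mul, add_mul, ← pow_succ'] at this
          omega
        have e2 : lexEdges m (n + 1) (m ^ (n + 1)) =
            m * lexEdges m n (m ^ n) + m.choose 2 := by
          rw [pow_succ', lexEdges_succ_mul hm]
        have e3 : a * lexEdges m n (m ^ n) + b * lexEdges m n (m ^ n) =
            m * lexEdges m n (m ^ n) + c * lexEdges m n (m ^ n) := by
          rw [← add_mul, hcm, add_mul]
        have e4 : m.choose 2 + c.choose 2 = a.choose 2 + b.choose 2 + u * v := by
          have : m = c + u + v := by omega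
          rw [this, hbc, hac, choose_two_add, choose_two_add, choose_two_add]
          ring
        rw [e1, e2, lexEdges_succ_add hm n (by omega) hc.le,
          lexCorners_succ_add hm n (by omega) hc.le]
        have hu0 : 0 < u := by omega
        have f1 : u + v ≤ u * v + 1 := by
          have hv0 : 0 < v := by omega
          nlinarith
        have f2 : v = 1 ∨ 2 * u ≤ u * v := by
          rcases eq_or_ne v 1 with h | h
          · exact Or.inl h
          · right
            rw [mul_comm]
            exact Nat.mul_le_mul_left _ (by omega)
        split_ifs <;> omega
    · have ih2 := ih'.2 hc
      have q1 : lexCorners m n (r + s - m ^ n) ≤ lexCorners m n r :=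
        lexCorners_mono hm n (by omega)
      have q2 : lexCorners m n (r + s - m ^ n) ≤ lexCorners m n s :=
        lexCorners_mono hm n (by omega)
      have k1 : min b (lexCorners m n s) + (b + if b < lexCorners m n s then 1 else 0) =
          min (b + 1) (lexCorners m n s) + b := by
        clear * -
        split_ifs <;> omega
      constructor
      · intro h
        -- The remainders fill one more copy, and `r + s - m ^ n` vertices are left over.
        have he : a + b + 1 ≤ m := by
          by_contra hcon
          have h2 : (m + 1) * m ^ n ≤ (a + b + 1) * m ^ n := Nat.mul_le_mul_right _ (by omega)
          have h3 : (m + 1) * m ^ n = m ^ (n + 1) + m ^ n := by ring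
          rw [h3, add_mul, add_mul] at h2
          omega
        have e1 : a * m ^ n + r + (b * m ^ n + s) =
            (a + b + 1) * m ^ n + (r + s - m ^ n) := by
          rw [add_mul, add_mul]
          omega
        have e3 : (a + b + 1).choose 2 = a.choose 2 + b.choose 2 + a * b + (a + b) := by
          rw [choose_two_add, choose_two_add]
          simp
        have key : min a (lexCorners m n r) + min (b + 1) (lexCorners m n s) +
            lexCorners m n (r + s - m ^ n) ≤ a * b + a +
              min (lexCorners m n r) (lexCorners m n s) +
              min (a + b + 1) (lexCorners m n (r + s - m ^ n)) := by
          have f2 : (b ≤ a * b ∧ 0 < lexCorners m n r) ∨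
              lexCorners m n s ≤ lexCorners m n r := by
            rcases hab with h1 | h1
            · exact Or.inl ⟨Nat.le_mul_of_pos_left b (by omega), by omega⟩
            · exact Or.inr (qsr h1.2)
          clear * - f2 q1 q2 hab
          generalize lexCorners m n (r + s - m ^ n) = qt at *
          generalize lexCorners m n r = qr at *
          generalize lexCorners m n s = qs at *
          generalize a * b = w at *
          omega
        rcases he.lt_or_eq with he' | he'
        · rw [e1, lexEdges_succ_add hm n he' (by omega), e3, add_mul, add_mul]
          clear * - key k1 ih2
          linarith
        · have ht : r + s - m ^ n = 0 := by
            have h2 : (a + b + 1) * m ^ n = m ^ (n + 1) := by rw [he', pow_succ']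
            omega
          rw [ht, lexEdges_zero, lexCorners_zero] at ih2
          rw [ht, lexCorners_zero, Nat.min_zero] at key
          rw [e1, ht, add_zero, lexEdges_succ_mul hm, e3, add_mul, add_mul]
          clear * - key k1 ih2
          linarith
      · intro h
        -- `x + y` exceeds `m ^ (n + 1)` by `c` full copies and `r + s - m ^ n` vertices.
        have he : m ≤ a + b + 1 := by
          by_contra hcon
          have h2 : (a + b + 2) * m ^ n ≤ m * m ^ n := Nat.mul_le_mul_right _ (by omega)
          rw [← pow_succ', add_mul, add_mul] at h2
          omega
        obtain ⟨c, hcm⟩ := Nat.exists_eq_add_of_le he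
        obtain ⟨u, hu⟩ := Nat.exists_eq_add_of_le (show a + 1 ≤ m from ha)
        obtain ⟨v, hv⟩ := Nat.exists_eq_add_of_le (show b + 1 ≤ m from hb)
        have hbc : b = c + u := by omega
        have hac : a = c + v := by omega
        have e1 : a * m ^ n + r + (b * m ^ n + s) - m ^ (n + 1) =
            c * m ^ n + (r + s - m ^ n) := by
          have : (a + b + 1) * m ^ n = (m + c) * m ^ n := by rw [hcm]
          rw [add_mul, add_mul, add_mul, ← pow_succ'] at this
          omega
        have e2 : lexEdges m (n + 1) (m ^ (n + 1)) =
            m * lexEdges m n (m ^ n) + m.choose 2 := by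
          rw [pow_succ', lexEdges_succ_mul hm]
        have e3 : a * lexEdges m n (m ^ n) + b * lexEdges m n (m ^ n) + lexEdges m n (m ^ n) =
            m * lexEdges m n (m ^ n) + c * lexEdges m n (m ^ n) := by
          rw [← add_mul, ← add_one_mul, hcm, add_mul]
        have e4 : m.choose 2 + c.choose 2 = a.choose 2 + b.choose 2 + u * v + (c + u + v) := by
          have : m = c + u + v + 1 := by omega
          rw [this, hbc, hac, choose_two_add, choose_two_add, choose_two_add, choose_two_add]
          simp
          ring
        rw [e1, e2, lexEdges_succ_add hm n (by omega) (by omega),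
          lexCorners_succ_add hm n (by omega) (by omega)]
        have f1 : v = 0 ∨ u ≤ u * v := by
          rcases Nat.eq_zero_or_pos v with h | h
          · exact Or.inl h
          · exact Or.inr (Nat.le_mul_of_pos_right u h)
        have key : min a (lexCorners m n r) + min (b + 1) (lexCorners m n s) +
            lexCorners m n (r + s - m ^ n) ≤ u * v + a +
              min (lexCorners m n r) (lexCorners m n s) +
              min (c + 1) (lexCorners m n (r + s - m ^ n)) := by
          have f2 : (b < a ∧ 0 < v) ∨ lexCorners m n s ≤ lexCorners m n r := by
            rcases hab with h1 | h1
            · exact Or.inl ⟨h1, by omega⟩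
            · exact Or.inr (qsr h1.2)
          clear * - f1 f2 q1 q2 hbc hac hab
          generalize lexCorners m n (r + s - m ^ n) = qt at *
          generalize lexCorners m n r = qr at *
          generalize lexCorners m n s = qs at *
          generalize u * v = w at *
          rcases le_total a qr with h | h
          · rw [min_eq_left h]
            omega
          · rw [min_eq_right h]
            omega
        have k2 : min c (lexCorners m n (r + s - m ^ n)) +
            (c + if c < lexCorners m n (r + s - m ^ n) then 1 else 0) =
            min (c + 1) (lexCorners m n (r + s - m ^ n)) + c := by
          clear * -
          split_ifs <;> omega
        clear * - key k1 k2 e3 e4 ih2 hbc hac hu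
        linarith

/-! ### Distributing vertices over the copies -/

/-- Among the ways of placing initial segments of nonincreasing sizes `ℓ 0, ℓ 1, …` into the
copies `i, i + 1, …` of `S(n,m)`, when the copies below `i` are full and copy `k` gains one edge
for each of its corners up to a total of `k` (or of `k + ε`, with `ε ≤ 1`), filling the copies one
after the other is best. The segments in the first and in the last copy are merged repeatedly. -/
theorem sum_lexEdges_le {m : ℕ} (hm : 0 < m) (n : ℕ) {ε : ℕ} (hε : ε ≤ 1) (d i : ℕ) (ℓ : ℕ → ℕ)
    (hi : i + d ≤ m) (hM : ∀ j < d, ℓ j ≤ m ^ n) (hℓ : ∀ j k, j ≤ k → k < d → ℓ k ≤ ℓ j) :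
    i * lexEdges m n (m ^ n) + i.choose 2 + ε * i +
        ∑ j ∈ Finset.range d, (lexEdges m n (ℓ j) + min (i + j + ε) (lexCorners m n (ℓ j))) ≤
      lexEdges m (n + 1) (i * m ^ n + ∑ j ∈ Finset.range d, ℓ j) +
        ε * lexCorners m (n + 1) (i * m ^ n + ∑ j ∈ Finset.range d, ℓ j) := by
  induction d generalizing i ℓ with
  | zero => simp [lexEdges_succ_mul hm, lexCorners_succ_mul hm]
  | succ d ih =>
    cases d with
    | zero =>
      simp only [zero_add, Finset.sum_range_one, add_zero]
      rw [lexEdges_succ_add hm n (by omega) (hM 0 (by omega)),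
        lexCorners_succ_add hm n (by omega) (hM 0 (by omega))]
      generalize i * lexEdges m n (m ^ n) = w
      interval_cases ε <;> split_ifs <;> omega
    | succ d =>
      have hlast : ℓ (d + 1) ≤ ℓ 0 := hℓ 0 (d + 1) (by omega) (by omega)
      have hc : (i + 1).choose 2 = i.choose 2 + i := by
        rw [choose_two_add]
        simp
      rcases (hM 0 (by omega)).lt_or_eq with hx | hx
      · have hex := lexEdges_exchange hm n hlast hx
        rcases le_or_gt (ℓ 0 + ℓ (d + 1)) (m ^ n) with hs | hs
        · -- The last segment fits into the first copy.
          have hex1 := hex.1 hs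
          have hq : lexCorners m n (ℓ 0) ≤ lexCorners m n (ℓ 0 + ℓ (d + 1)) :=
            lexCorners_mono hm n (by omega)
          have h := ih i (fun j => if j = 0 then ℓ 0 + ℓ (d + 1) else ℓ j) (by omega)
            (by
              intro j hj
              by_cases h0 : j = 0
              · simpa [h0] using hs
              · simpa [h0] using hM j (by omega))
            (by
              intro j k hjk hk
              by_cases hk0 : k = 0
              · have hj0 : j = 0 := by omega
                simp [hk0, hj0]
              · have h1 := hℓ j k hjk (by omega)
                by_cases hj0 : j = 0
                · subst hj0
                  simp [hk0]
                  omega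
                · simpa [hk0, hj0] using h1)
          rw [Finset.sum_range_succ', Finset.sum_range_succ'] at h
          rw [Finset.sum_range_succ, Finset.sum_range_succ', Finset.sum_range_succ _ (d + 1),
            Finset.sum_range_succ' _ d]
          simp only [Nat.add_eq_zero_iff, one_ne_zero, and_false, if_false, if_true] at h
          have e : ∑ k ∈ Finset.range d, ℓ (k + 1) + ℓ 0 + ℓ (d + 1) =
              ∑ k ∈ Finset.range d, ℓ (k + 1) + (ℓ 0 + ℓ (d + 1)) := by ring
          rw [e]
          refine le_trans ?_ h
          clear * - hex1 hq
          omega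
        · -- The first copy is filled up from the last segment.
          have hex2 := hex.2 hs.le
          have hz : ℓ 0 + ℓ (d + 1) - m ^ n ≤ ℓ (d + 1) := by omega
          have hq : lexCorners m n (ℓ 0 + ℓ (d + 1) - m ^ n) ≤ lexCorners m n (ℓ (d + 1)) :=
            lexCorners_mono hm n hz
          have h := ih (i + 1)
            (fun j => if j = d then ℓ 0 + ℓ (d + 1) - m ^ n else ℓ (j + 1)) (by omega)
            (by
              intro j hj
              have := hM (d + 1) (by omega)
              by_cases h0 : j = d
              · simp [h0]
                omega
              · simpa [h0] using hM (j + 1) (by omega))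
            (by
              intro j k hjk hk
              have h1 := hℓ (j + 1) (k + 1) (by omega) (by omega)
              by_cases hj0 : j = d
              · have hk0 : k = d := by omega
                simp [hk0, hj0]
              · by_cases hk0 : k = d
                · subst hk0
                  simp [hj0]
                  omega
                · simpa [hk0, hj0] using h1)
          rw [Finset.sum_range_succ, Finset.sum_range_succ] at h
          rw [Finset.sum_range_succ, Finset.sum_range_succ', Finset.sum_range_succ _ (d + 1),
            Finset.sum_range_succ' _ d]
          have e1 : ∑ k ∈ Finset.range d,
              (if k = d then ℓ 0 + ℓ (d + 1) - m ^ n else ℓ (k + 1)) =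
              ∑ k ∈ Finset.range d, ℓ (k + 1) := by
            refine Finset.sum_congr rfl fun k hk => ?_
            rw [if_neg (Finset.mem_range.1 hk).ne]
          have e2 : ∑ k ∈ Finset.range d,
              (lexEdges m n (if k = d then ℓ 0 + ℓ (d + 1) - m ^ n else ℓ (k + 1)) +
                min (i + 1 + k + ε)
                  (lexCorners m n (if k = d then ℓ 0 + ℓ (d + 1) - m ^ n else ℓ (k + 1)))) =
              ∑ k ∈ Finset.range d,
                (lexEdges m n (ℓ (k + 1)) + min (i + (k + 1) + ε) (lexCorners m n (ℓ (k + 1)))) := by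
            refine Finset.sum_congr rfl fun k hk => ?_
            rw [if_neg (Finset.mem_range.1 hk).ne, add_right_comm i 1 k, add_assoc i k 1]
          rw [e1, e2] at h
          simp only [if_true] at h
          have e : (i + 1) * m ^ n + (∑ k ∈ Finset.range d, ℓ (k + 1) +
              (ℓ 0 + ℓ (d + 1) - m ^ n)) =
              i * m ^ n + (∑ k ∈ Finset.range d, ℓ (k + 1) + ℓ 0 + ℓ (d + 1)) := by
            rw [add_mul]
            omega
          rw [e] at h
          refine le_trans ?_ h
          rw [hc, add_mul, mul_add]
          clear * - hex2 hq
          omega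
      · -- The first copy is full.
        have h := ih (i + 1) (fun j => ℓ (j + 1)) (by omega) (fun j hj => hM _ (by omega))
          (fun j k hjk hk => hℓ _ _ (by omega) (by omega))
        rw [Finset.sum_range_succ' _ (d + 1), Finset.sum_range_succ' _ (d + 1), hx,
          lexCorners_pow hm, min_eq_left (by omega : i + 0 + ε ≤ m)]
        have e : (i + 1) * m ^ n + ∑ k ∈ Finset.range (d + 1), ℓ (k + 1) =
            i * m ^ n + (∑ k ∈ Finset.range (d + 1), ℓ (k + 1) + m ^ n) := by ring
        rw [e] at h
        refine le_trans (le_of_eq ?_) h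
        have e2 : ∀ k, i + 1 + k + ε = i + (k + 1) + ε := fun k => by ring
        simp only [e2]
        rw [hc, add_mul, mul_add]
        ring

/-- For any permutation `σ` listing the copies of `S(n,m)` in nonincreasing order of the sizes
`ℓ c`, if copy `c` gains at most one edge for each of its corners towards an earlier copy, and for
its own corner if `c ∈ T`, then filling the copies one after the other is best. -/
theorem sum_lexEdges_sort_le {m : ℕ} (hm : 0 < m) (n : ℕ) (ℓ : Fin m → ℕ)
    (hM : ∀ c, ℓ c ≤ m ^ n) (σ : Equiv.Perm (Fin m)) (hσ : Antitone (ℓ ∘ σ))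
    (T : Finset (Fin m)) :
    ∑ c, (lexEdges m n (ℓ c) +
        min ((σ.symm c : ℕ) + if c ∈ T then 1 else 0) (lexCorners m n (ℓ c))) ≤
      lexEdges m (n + 1) (∑ c, ℓ c) + min T.card (lexCorners m (n + 1) (∑ c, ℓ c)) := by
  have main : ∀ ε ≤ 1, ∑ c, (lexEdges m n (ℓ c) +
      min ((σ.symm c : ℕ) + ε) (lexCorners m n (ℓ c))) ≤
      lexEdges m (n + 1) (∑ c, ℓ c) + ε * lexCorners m (n + 1) (∑ c, ℓ c) := by
    intro ε hε
    let f : ℕ → ℕ := fun j => if h : j < m then ℓ (σ ⟨j, h⟩) else 0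
    have hf : ∀ j : Fin m, f j = ℓ (σ j) := fun j => by simp [f]
    have h := sum_lexEdges_le hm n hε m 0 f (by omega)
      (fun j hj => by simpa [f, hj] using hM _)
      (fun j k hjk hk => by
        have := hσ (show (⟨j, by omega⟩ : Fin m) ≤ ⟨k, hk⟩ from hjk)
        simpa [f, hk, show j < m by omega] using this)
    rw [← Fin.sum_univ_eq_sum_range f, ← Fin.sum_univ_eq_sum_range
      (fun j => lexEdges m n (f j) + min (0 + j + ε) (lexCorners m n (f j)))] at h
    simp only [hf, zero_mul, zero_add, mul_zero, Nat.choose_zero_succ] at h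
    rw [Equiv.sum_comp σ] at h
    refine le_trans (le_of_eq ?_) h
    rw [← Equiv.sum_comp σ]
    simp
  -- Each letter of `T` adds at most one to the sum with `ε = 0`, and the sum with `ε = 1` counts
  -- every letter; these two bounds give the two arguments of the minimum.
  have h0 := main 0 (by omega)
  have h1 := main 1 le_rfl
  have hT : ∑ c : Fin m, (if c ∈ T then 1 else 0) = T.card := by simp
  rw [min_def]
  split_ifs
  · refine le_trans ?_ (Nat.add_le_add_right (by simpa using h0) _)
    rw [← hT, ← Finset.sum_add_distrib]
    refine Finset.sum_le_sum fun c _ => ?_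
    omega
  · refine le_trans (Finset.sum_le_sum fun c _ => ?_) (by simpa using h1)
    split_ifs <;> omega

/-! ### Decomposition of the Sierpinski graph into copies -/

/-- The extreme vertex `(c, …, c)` of `S(n,m)`. -/
def corner (n : ℕ) {m : ℕ} (c : Fin m) : Fin n → Fin m := fun _ => c

theorem cons_eq_corner {n m : ℕ} {b c : Fin m} {v : Fin n → Fin m} :
    (Fin.cons b v : Fin (n + 1) → Fin m) = corner (n + 1) c ↔ b = c ∧ v = corner n c := by
  constructor
  · intro h
    refine ⟨by simpa [corner] using congrFun h 0, funext fun i => ?_⟩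
    simpa [corner] using congrFun h i.succ
  · rintro ⟨rfl, rfl⟩
    funext i
    refine Fin.cases ?_ (fun j => ?_) i <;> simp [corner]

theorem sierpinskiGraph_adj_cons {n m : ℕ} {b c : Fin m} {v w : Fin n → Fin m} :
    (sierpinskiGraph (n + 1) m).Adj (Fin.cons b v) (Fin.cons c w) ↔
      (b = c ∧ (sierpinskiGraph n m).Adj v w) ∨ (b ≠ c ∧ v = corner n c ∧ w = corner n b) := by
  constructor
  · rintro ⟨h, h1, h2, h3⟩
    induction h using Fin.cases with
    | zero =>
      refine Or.inr ⟨by simpa using h2, ?_, ?_⟩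
      · funext j
        simpa [corner] using (h3 j.succ (Fin.succ_pos j)).1
      · funext j
        simpa [corner] using (h3 j.succ (Fin.succ_pos j)).2
    | succ h =>
      refine Or.inl ⟨by simpa using h1 0 (Fin.succ_pos h), h, fun i hi => ?_, by simpa using h2,
        fun j hj => ?_⟩
      · simpa using h1 i.succ (Fin.succ_lt_succ_iff.2 hi)
      · simpa using h3 j.succ (Fin.succ_lt_succ_iff.2 hj)
  · rintro (⟨rfl, h, h1, h2, h3⟩ | ⟨h, rfl, rfl⟩)
    · refine ⟨h.succ, fun i hi => ?_, by simpa using h2, fun j hj => ?_⟩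
      · induction i using Fin.cases with
        | zero => simp
        | succ i => simpa using h1 i (Fin.succ_lt_succ_iff.1 hi)
      · induction j using Fin.cases with
        | zero => exact absurd hj (by simp)
        | succ j => simpa using h3 j (Fin.succ_lt_succ_iff.1 hj)
    · refine ⟨0, fun i hi => absurd hi (by simp), by simpa using h, fun j hj => ?_⟩
      induction j using Fin.cases with
      | zero => exact absurd hj (by simp)
      | succ j => simp [corner]

theorem sum_cons {n m : ℕ} (f : (Fin (n + 1) → Fin m) → ℕ) :
    ∑ v, f v = ∑ b : Fin m, ∑ v : Fin n → Fin m, f (Fin.cons b v) := by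
  rw [← Equiv.sum_comp (Fin.consEquiv fun _ => Fin m), Fintype.sum_prod_type]
  rfl

/-- The part of a vertex set of `S(n+1,m)` in copy `b` of `S(n,m)`. -/
def copyPart {n m : ℕ} (S : Finset (Fin (n + 1) → Fin m)) (b : Fin m) : Finset (Fin n → Fin m) :=
  Finset.univ.filter fun v => Fin.cons b v ∈ S

theorem mem_copyPart {n m : ℕ} {S : Finset (Fin (n + 1) → Fin m)} {b : Fin m}
    {v : Fin n → Fin m} : v ∈ copyPart S b ↔ Fin.cons b v ∈ S := by
  simp [copyPart]

theorem sum_card_copyPart {n m : ℕ} (S : Finset (Fin (n + 1) → Fin m)) :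
    ∑ b, (copyPart S b).card = S.card := by
  have h : S.card = ∑ v, if v ∈ S then 1 else 0 := by simp
  rw [h, sum_cons]
  refine Finset.sum_congr rfl fun b _ => ?_
  simp [copyPart]

theorem corner_mem_copyPart {n m : ℕ} {S : Finset (Fin (n + 1) → Fin m)} {c : Fin m} :
    corner n c ∈ copyPart S c ↔ corner (n + 1) c ∈ S := by
  rw [mem_copyPart, cons_eq_corner.2 ⟨rfl, rfl⟩]

open Classical in
/-- The number of ordered pairs of adjacent vertices in `S`, that is, twice the number of edges
spanned by `S`. -/
noncomputable def adjPairs {V : Type*} [Fintype V] (G : SimpleGraph V) (S : Finset V) : ℕ :=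
  ∑ v, ∑ w, if v ∈ S ∧ w ∈ S ∧ G.Adj v w then 1 else 0

theorem adjPairs_succ {n m : ℕ} (S : Finset (Fin (n + 1) → Fin m)) :
    adjPairs (sierpinskiGraph (n + 1) m) S =
      ∑ b, adjPairs (sierpinskiGraph n m) (copyPart S b) +
      ∑ b, ∑ c, if b ≠ c ∧ corner n c ∈ copyPart S b ∧ corner n b ∈ copyPart S c
        then 1 else 0 := by
  classical
  have key : ∀ b c : Fin m, (∑ v : Fin n → Fin m, ∑ w : Fin n → Fin m,
      if (Fin.cons b v : Fin (n + 1) → Fin m) ∈ S ∧ (Fin.cons c w : Fin (n + 1) → Fin m) ∈ S ∧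
        (sierpinskiGraph (n + 1) m).Adj (Fin.cons b v) (Fin.cons c w) then 1 else 0) =
      (if b = c then adjPairs (sierpinskiGraph n m) (copyPart S b) else 0) +
      if b ≠ c ∧ corner n c ∈ copyPart S b ∧ corner n b ∈ copyPart S c then 1 else 0 := by
    intro b c
    by_cases h : b = c
    · subst h
      simp [sierpinskiGraph_adj_cons, adjPairs, mem_copyPart]
    · simp only [sierpinskiGraph_adj_cons, h, false_and, ne_eq, not_false_eq_true, true_and,
        false_or, if_false, zero_add, ← mem_copyPart (S := S)]
      rw [Finset.sum_eq_single (corner n c), Finset.sum_eq_single (corner n b)]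
      · simp
      · intro w _ hw
        simp [hw]
      · simp
      · intro v _ hv
        simp [hv]
      · simp
  rw [adjPairs, sum_cons]
  simp only [sum_cons (n := n)]
  have hswap : ∀ b : Fin m, (∑ v : Fin n → Fin m, ∑ c : Fin m, ∑ w : Fin n → Fin m,
      if (Fin.cons b v : Fin (n + 1) → Fin m) ∈ S ∧ (Fin.cons c w : Fin (n + 1) → Fin m) ∈ S ∧
        (sierpinskiGraph (n + 1) m).Adj (Fin.cons b v) (Fin.cons c w) then 1 else 0) =
      ∑ c, ((if b = c then adjPairs (sierpinskiGraph n m) (copyPart S b) else 0) +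
      if b ≠ c ∧ corner n c ∈ copyPart S b ∧ corner n b ∈ copyPart S c then 1 else 0) := by
    intro b
    rw [Finset.sum_comm]
    exact Finset.sum_congr rfl fun c _ => key b c
  trans ∑ b, ∑ c, ((if b = c then adjPairs (sierpinskiGraph n m) (copyPart S b) else 0) +
      if b ≠ c ∧ corner n c ∈ copyPart S b ∧ corner n b ∈ copyPart S c then 1 else 0)
  · refine Finset.sum_congr rfl fun b _ => ?_
    rw [← hswap b]
    congr!
  · simp [Finset.sum_add_distrib]

/-! ### The upper bound on edges -/

/-- Initial segments of the lexicographic order span the most edges, even if additional pendant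
edges at an arbitrary set `T` of corners are counted. Allowing these edges makes the induction
work: list the copies by decreasing size and charge the edge between two copies to its end in the
smaller one, so that it becomes a pendant edge there. -/
theorem adjPairs_add_corners_le (n m : ℕ) (S : Finset (Fin n → Fin m)) (T : Finset (Fin m)) :
    adjPairs (sierpinskiGraph n m) S + 2 * (T.filter fun c => corner n c ∈ S).card ≤
      2 * lexEdges m n S.card + 2 * min T.card (lexCorners m n S.card) := by
  rcases Nat.eq_zero_or_pos m with rfl | hm
  · have hT : T = ∅ := Finset.eq_empty_of_isEmpty T
    cases n with
    | zero => simp [hT, adjPairs, sierpinskiGraph]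
    | succ n =>
      have : IsEmpty (Fin (n + 1) → Fin 0) := ⟨fun v => (v 0).elim0⟩
      simp [hT, adjPairs]
  induction n generalizing T with
  | zero =>
    have h0 : adjPairs (sierpinskiGraph 0 m) S = 0 := by simp [adjPairs, sierpinskiGraph]
    rw [h0]
    rcases S.eq_empty_or_nonempty with rfl | hS
    · simp
    · have h1 : lexCorners m 0 S.card = m := by simp [lexCorners, hS.ne_empty]
      have h2 := T.card_filter_le fun c => corner 0 c ∈ S
      have h3 : T.card ≤ m := by simpa using T.card_le_univ
      rw [h1, min_eq_left h3]
      omega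
  | succ n ih =>
    obtain ⟨σ, hσ⟩ : ∃ σ : Equiv.Perm (Fin m),
        Antitone ((fun c => (copyPart S c).card) ∘ σ) :=
      ⟨_, fun i j h => Tuple.monotone_sort
        (fun c => OrderDual.toDual (copyPart S c).card) h⟩
    have hcard : ∀ c, (copyPart S c).card ≤ m ^ n := fun c => by
      simpa using (copyPart S c).card_le_univ
    have hmain := sum_lexEdges_sort_le hm n (fun c => (copyPart S c).card) hcard σ hσ T
    simp only [sum_card_copyPart] at hmain
    -- The corners of copy `c` that receive a pendant edge.
    let U : Fin m → Finset (Fin m) := fun c =>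
      Finset.univ.filter fun b => σ.symm b < σ.symm c ∨ (b = c ∧ c ∈ T)
    have hU : ∀ c, (U c).card = (σ.symm c : ℕ) + if c ∈ T then 1 else 0 := by
      intro c
      have h1 : (Finset.univ.filter fun b => σ.symm b < σ.symm c).card = (σ.symm c : ℕ) := by
        rw [← Fin.card_Iio (σ.symm c)]
        exact Finset.card_equiv σ.symm (by simp)
      have h2 : (Finset.univ.filter fun b => b = c ∧ c ∈ T).card = if c ∈ T then 1 else 0 := by
        by_cases h : c ∈ T <;> simp [h, Finset.filter_eq']
      rw [← h1, ← h2, ← Finset.card_union_of_disjoint, ← Finset.filter_or]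
      rw [Finset.disjoint_filter]
      rintro b - hb ⟨rfl, -⟩
      exact lt_irrefl _ hb
    have hUS : ∀ c, ((U c).filter fun b => corner n b ∈ copyPart S c).card =
        (∑ b, if σ.symm b < σ.symm c ∧ corner n b ∈ copyPart S c then 1 else 0) +
          if c ∈ T ∧ corner (n + 1) c ∈ S then 1 else 0 := by
      intro c
      have h2 : (if c ∈ T ∧ corner (n + 1) c ∈ S then 1 else 0) =
          ∑ b, if b = c ∧ c ∈ T ∧ corner (n + 1) c ∈ S then 1 else 0 := by
        by_cases h : c ∈ T ∧ corner (n + 1) c ∈ S <;> simp [h]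
      rw [h2, ← Finset.sum_add_distrib, Finset.filter_filter, Finset.card_filter]
      refine Finset.sum_congr rfl fun b _ => ?_
      by_cases hbc : b = c
      · subst hbc
        simp [corner_mem_copyPart]
      · simp [hbc]
    have hcross : (∑ b, ∑ c, if b ≠ c ∧ corner n c ∈ copyPart S b ∧ corner n b ∈ copyPart S c
        then 1 else 0) ≤
        2 * ∑ c, ∑ b, if σ.symm b < σ.symm c ∧ corner n b ∈ copyPart S c then 1 else 0 := by
      rw [two_mul]
      nth_rewrite 2 [Finset.sum_comm]
      rw [← Finset.sum_add_distrib]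
      refine Finset.sum_le_sum fun b _ => ?_
      rw [← Finset.sum_add_distrib]
      refine Finset.sum_le_sum fun c _ => ?_
      by_cases h : b ≠ c ∧ corner n c ∈ copyPart S b ∧ corner n b ∈ copyPart S c
      · have h1 : σ.symm b ≠ σ.symm c := fun h' => h.1 (σ.symm.injective h')
        rcases lt_or_gt_of_ne h1 with h2 | h2
        · rw [if_pos h, if_pos (show σ.symm b < σ.symm c ∧ _ from ⟨h2, h.2.2⟩)]
          omega
        · rw [if_pos h, if_pos (show σ.symm c < σ.symm b ∧ _ from ⟨h2, h.2.1⟩)]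
          omega
      · rw [if_neg h]
        omega
    have hT : (T.filter fun c => corner (n + 1) c ∈ S).card =
        ∑ c, if c ∈ T ∧ corner (n + 1) c ∈ S then 1 else 0 := by
      rw [← Finset.card_filter]
      congr 1
      ext c
      simp
    have hih := Finset.sum_le_sum fun c (_ : c ∈ Finset.univ) => ih (copyPart S c) (U c)
    simp only [hUS, hU, mul_add, Finset.sum_add_distrib, ← Finset.mul_sum] at hih
    simp only [Finset.sum_add_distrib] at hmain
    have hs := adjPairs_succ S
    rw [hT, hs]
    omega

/-! ### Initial segments of the lexicographic order -/

theorem toLex_cons_le_cons {n m : ℕ} {b c : Fin m} {v w : Fin n → Fin m} :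
    toLex (Fin.cons c w : Fin (n + 1) → Fin m) ≤ toLex (Fin.cons b v : Fin (n + 1) → Fin m) ↔
      c < b ∨ (c = b ∧ toLex w ≤ toLex v) := by
  have h : toLex (Fin.cons c w : Fin (n + 1) → Fin m) <
      toLex (Fin.cons b v : Fin (n + 1) → Fin m) ↔ c < b ∨ (c = b ∧ toLex w < toLex v) :=
    Fin.pi_lex_lt_cons_cons (α := fun _ : Fin (n + 1) => Fin m) (fun {_} x y => x < y)
  refine le_iff_lt_or_eq.trans ((or_congr h toLex_inj).trans ?_)
  rw [le_iff_lt_or_eq (a := toLex w), toLex_inj, Fin.cons_inj]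
  tauto

theorem sum_ite_lt {m : ℕ} (a : Fin m) (k : ℕ) : (∑ b, if b < a then k else 0) = a * k := by
  rw [← Finset.sum_filter, Finset.sum_const, smul_eq_mul]
  congr 1
  rw [← Fin.card_Iio a]
  congr 1
  ext c
  simp

theorem lexPosition_pos {n m : ℕ} (v : Fin n → Fin m) : 0 < lexPosition v :=
  Finset.card_pos.2 ⟨v, by simp⟩

theorem lexPosition_le {n m : ℕ} (v : Fin n → Fin m) : lexPosition v ≤ m ^ n := by
  refine (Finset.card_le_univ _).trans ?_
  simp

theorem lexPosition_cons {n m : ℕ} (b : Fin m) (v : Fin n → Fin m) :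
    lexPosition (Fin.cons b v : Fin (n + 1) → Fin m) = b * m ^ n + lexPosition v := by
  have key : ∀ c : Fin m, (∑ w : Fin n → Fin m,
      if toLex (Fin.cons c w : Fin (n + 1) → Fin m) ≤
        toLex (Fin.cons b v : Fin (n + 1) → Fin m) then 1 else 0) =
      (if c < b then m ^ n else 0) + if c = b then lexPosition v else 0 := by
    intro c
    simp only [toLex_cons_le_cons]
    rcases lt_trichotomy c b with h | h | h
    · simp [h, h.ne]
    · subst h
      simp [lexPosition]
    · simp [h.not_gt, h.ne']
  rw [lexPosition, Finset.card_filter, sum_cons, Finset.sum_congr rfl fun c _ => key c,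
    Finset.sum_add_distrib]
  simp [sum_ite_lt]

theorem mem_lexInitial {n m ℓ : ℕ} {v : Fin n → Fin m} :
    v ∈ lexInitial n m ℓ ↔ lexPosition v ≤ ℓ := by
  simp [lexInitial]

theorem lexInitial_pow (n m : ℕ) : lexInitial n m (m ^ n) = Finset.univ := by
  ext v
  simp [mem_lexInitial, lexPosition_le]

/-- The lexicographic initial segment of size `a * m ^ n + r` consists of the first `a` copies of
`S(n,m)` and of the initial segment of size `r` in copy `a`. -/
theorem copyPart_lexInitial {n m r : ℕ} (a b : Fin m) (hr : r ≤ m ^ n) :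
    copyPart (lexInitial (n + 1) m (a * m ^ n + r)) b =
      if b < a then Finset.univ else if b = a then lexInitial n m r else ∅ := by
  ext v
  rw [mem_copyPart, mem_lexInitial, lexPosition_cons]
  have h1 := lexPosition_pos v
  have h2 := lexPosition_le v
  rcases lt_trichotomy b a with h | h | h
  · have h3 : ((b : ℕ) + 1) * m ^ n ≤ a * m ^ n := Nat.mul_le_mul_right _ h
    rw [add_mul] at h3
    simp [h]
    omega
  · subst h
    simp [mem_lexInitial]
  · have h3 : ((a : ℕ) + 1) * m ^ n ≤ b * m ^ n := Nat.mul_le_mul_right _ h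
    rw [add_mul] at h3
    simp [h.not_gt, h.ne']
    omega

theorem exists_eq_mul_pow_add {m : ℕ} (hm : 0 < m) (n : ℕ) {ℓ : ℕ} (hℓ : ℓ ≤ m ^ (n + 1)) :
    ∃ (a : Fin m) (r : ℕ), r ≤ m ^ n ∧ ℓ = a * m ^ n + r := by
  have hM : 0 < m ^ n := Nat.pow_pos hm
  rcases hℓ.lt_or_eq with h | rfl
  · exact ⟨⟨ℓ / m ^ n, Nat.div_lt_of_lt_mul (by rwa [pow_succ] at h)⟩, ℓ % m ^ n,
      (Nat.mod_lt _ hM).le, (Nat.div_add_mod' _ _).symm⟩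
  · refine ⟨⟨m - 1, by omega⟩, m ^ n, le_rfl, ?_⟩
    rw [← Nat.succ_mul, pow_succ', Nat.succ_eq_add_one, Nat.sub_add_cancel hm]

theorem lexInitial_zero_of_pos {m ℓ : ℕ} (hℓ : 0 < ℓ) : lexInitial 0 m ℓ = Finset.univ := by
  ext v
  have := lexPosition_le v
  rw [pow_zero] at this
  simp only [mem_lexInitial, Finset.mem_univ, iff_true]
  omega

theorem lexInitial_self_zero (n m : ℕ) : lexInitial n m 0 = ∅ := by
  ext v
  have := lexPosition_pos v
  simp [mem_lexInitial]
  omega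

theorem card_lexInitial {n m ℓ : ℕ} (hℓ : ℓ ≤ m ^ n) : (lexInitial n m ℓ).card = ℓ := by
  rcases Nat.eq_zero_or_pos ℓ with rfl | hpos
  · simp [lexInitial_self_zero]
  induction n generalizing ℓ with
  | zero =>
    have h1 : ℓ = 1 := by
      have : ℓ ≤ 1 := by simpa using hℓ
      omega
    subst h1
    simp [lexInitial_zero_of_pos]
  | succ n ih =>
    have hm : 0 < m := by
      by_contra h
      have h0 : m = 0 := by omega
      simp [h0] at hℓ
      omega
    obtain ⟨a, r, hr, rfl⟩ := exists_eq_mul_pow_add hm n hℓ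
    have hcr : (lexInitial n m r).card = r := by
      rcases Nat.eq_zero_or_pos r with rfl | h
      · simp [lexInitial_self_zero]
      · exact ih hr h
    have key : ∀ b, (copyPart (lexInitial (n + 1) m (a * m ^ n + r)) b).card =
        (if b < a then m ^ n else 0) + if b = a then r else 0 := by
      intro b
      rw [copyPart_lexInitial a b hr]
      rcases lt_trichotomy b a with h | h | h
      · simp [h, h.ne]
      · simp [h, hcr]
      · simp [h.not_gt, h.ne']
    rw [← sum_card_copyPart, Finset.sum_congr rfl fun b _ => key b, Finset.sum_add_distrib]
    simp [sum_ite_lt]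

/-- The corners in an initial segment are those of the first `lexCorners m n ℓ` letters. -/
theorem lexCorners_spec {m : ℕ} (hm : 0 < m) (n : ℕ) {ℓ : ℕ} (hℓ : ℓ ≤ m ^ n) (c : Fin m) :
    corner n c ∈ lexInitial n m ℓ ↔ (c : ℕ) < lexCorners m n ℓ := by
  induction n generalizing ℓ with
  | zero =>
    rcases Nat.eq_zero_or_pos ℓ with rfl | h
    · simp [lexInitial_self_zero, lexCorners]
    · simp only [lexInitial_zero_of_pos h, Finset.mem_univ, lexCorners, h.ne', if_false, c.2]
  | succ n ih =>
    obtain ⟨a, r, hr, rfl⟩ := exists_eq_mul_pow_add hm n hℓ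
    rw [← corner_mem_copyPart, copyPart_lexInitial a c hr, lexCorners_succ_add hm n a.2 hr]
    rcases lt_trichotomy c a with h | h | h
    · have h' : (c : ℕ) < a := h
      simp [h]
      omega
    · subst h
      simp only [lt_irrefl, if_false, if_true, ih hr]
      split_ifs <;> omega
    · have h' : (a : ℕ) < c := h
      simp only [h.not_gt, h.ne', if_false, Finset.notMem_empty, false_iff]
      split_ifs <;> omega

theorem adjPairs_lexInitial {m : ℕ} (hm : 0 < m) (n : ℕ) {ℓ : ℕ} (hℓ : ℓ ≤ m ^ n) :
    adjPairs (sierpinskiGraph n m) (lexInitial n m ℓ) = 2 * lexEdges m n ℓ := by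
  induction n generalizing ℓ with
  | zero => simp [adjPairs, sierpinskiGraph, lexEdges]
  | succ n ih =>
    obtain ⟨a, r, hr, rfl⟩ := exists_eq_mul_pow_add hm n hℓ
    have hfull := ih (le_refl (m ^ n))
    rw [lexInitial_pow] at hfull
    have hempty : adjPairs (sierpinskiGraph n m) (∅ : Finset (Fin n → Fin m)) = 0 := by
      simp [adjPairs]
    have h1 : ∑ b, adjPairs (sierpinskiGraph n m)
        (copyPart (lexInitial (n + 1) m (a * m ^ n + r)) b) =
        a * (2 * lexEdges m n (m ^ n)) + 2 * lexEdges m n r := by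
      have key : ∀ b, adjPairs (sierpinskiGraph n m)
          (copyPart (lexInitial (n + 1) m (a * m ^ n + r)) b) =
          (if b < a then 2 * lexEdges m n (m ^ n) else 0) +
            if b = a then 2 * lexEdges m n r else 0 := by
        intro b
        rw [copyPart_lexInitial a b hr]
        rcases lt_trichotomy b a with h | h | h
        · simp [h, h.ne, hfull]
        · simp [h, ih hr]
        · simp [h.not_gt, h.ne', hempty]
      rw [Finset.sum_congr rfl fun b _ => key b, Finset.sum_add_distrib, sum_ite_lt]
      simp
    have h2 : (∑ c : Fin m, if c < a ∧ corner n c ∈ lexInitial n m r then 1 else 0) =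
        min (a : ℕ) (lexCorners m n r) := by
      have hq : min (a : ℕ) (lexCorners m n r) < m := by omega
      rw [← Finset.card_filter]
      trans (Finset.Iio (⟨_, hq⟩ : Fin m)).card
      · congr 1
        ext c
        simp only [Finset.mem_filter, Finset.mem_univ, true_and, Finset.mem_Iio,
          lexCorners_spec hm n hr, Fin.lt_def, lt_min_iff]
      · simp
    have h3 : (∑ b, ∑ c, if b ≠ c ∧
        corner n c ∈ copyPart (lexInitial (n + 1) m (a * m ^ n + r)) b ∧
        corner n b ∈ copyPart (lexInitial (n + 1) m (a * m ^ n + r)) c then 1 else 0) =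
        2 * (a : ℕ).choose 2 + 2 * min (a : ℕ) (lexCorners m n r) := by
      have key : ∀ b c : Fin m, (if b ≠ c ∧
          corner n c ∈ copyPart (lexInitial (n + 1) m (a * m ^ n + r)) b ∧
          corner n b ∈ copyPart (lexInitial (n + 1) m (a * m ^ n + r)) c then 1 else 0) =
          (if b < a then if c < a then if b = c then 0 else 1 else 0 else 0) +
          (if c = a then if b < a ∧ corner n b ∈ lexInitial n m r then 1 else 0 else 0) +
          (if b = a then if c < a ∧ corner n c ∈ lexInitial n m r then 1 else 0 else 0) := by
        intro b c
        rw [copyPart_lexInitial a b hr, copyPart_lexInitial a c hr]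
        rcases lt_trichotomy b a with hb | hb | hb <;> rcases lt_trichotomy c a with hc | hc | hc
        · by_cases hbc : b = c <;> simp [hb, hc, hb.ne, hc.ne, hbc]
        · simp [hb, hc, hb.ne]
        · simp [hb, hb.ne, hc.not_gt, hc.ne']
        · simp [hb, hc, hc.ne, hc.ne']
        · simp [hb, hc]
        · simp [hb, hc.not_gt, hc.ne']
        · simp [hc, hb.not_gt, hc.ne, hb.ne']
        · simp [hc, hb.not_gt, hb.ne']
        · simp [hb.not_gt, hb.ne', hc.ne']
      simp only [key, Finset.sum_add_distrib]
      have h4 : (∑ b : Fin m, ∑ c : Fin m,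
          if b < a then if c < a then if b = c then 0 else 1 else 0 else 0) =
          2 * (a : ℕ).choose 2 := by
        have h5 : ∀ b : Fin m, (∑ c : Fin m,
            if b < a then if c < a then if b = c then 0 else 1 else 0 else 0) =
            if b < a then (a : ℕ) - 1 else 0 := by
          intro b
          by_cases hb : b < a
          · simp only [hb, if_true]
            trans ((Finset.Iio a).erase b).card
            · have he : (Finset.Iio a).erase b = Finset.univ.filter fun c => c < a ∧ b ≠ c := by
                ext c
                simp [and_comm, eq_comm]
              rw [he, Finset.card_filter]
              refine Finset.sum_congr rfl fun c _ => ?_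
              by_cases hc : c < a <;> by_cases hbc : b = c <;> simp [hc, hbc]
            · rw [Finset.card_erase_of_mem (by simpa using hb), Fin.card_Iio]
          · simp [hb]
        rw [Finset.sum_congr rfl fun b _ => h5 b, sum_ite_lt, Nat.choose_two_right,
          Nat.mul_div_cancel' (Nat.even_mul_pred_self _).two_dvd]
      have h6 : (∑ b : Fin m, ∑ c : Fin m, if c = a then
          if b < a ∧ corner n b ∈ lexInitial n m r then 1 else 0 else 0) =
          min (a : ℕ) (lexCorners m n r) := by
        simp only [Finset.sum_ite_eq', Finset.mem_univ, if_true, h2]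
      have h7 : (∑ b : Fin m, ∑ c : Fin m, if b = a then
          if c < a ∧ corner n c ∈ lexInitial n m r then 1 else 0 else 0) =
          min (a : ℕ) (lexCorners m n r) := by
        rw [Finset.sum_comm]
        simp only [Finset.sum_ite_eq', Finset.mem_univ, if_true, h2]
      rw [h4, h6, h7]
      ring
    rw [adjPairs_succ, h1, h3, lexEdges_succ_add hm n a.2 hr]
    ring

/-! ### The edge boundary -/

open Classical in
/-- Every vertex of `S(n,m)` has degree `m` if each corner is given a pendant edge; for `n = 0`
the single vertex is the corner of each of the `m` letters and gets `m` pendant edges. -/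
theorem degree_add_corners {n m : ℕ} (v : Fin n → Fin m) :
    (∑ w, if (sierpinskiGraph n m).Adj v w then 1 else 0) +
      (∑ c : Fin m, if v = corner n c then 1 else 0) = m := by
  induction n with
  | zero =>
    have h : ∀ c : Fin m, v = corner 0 c := fun c => Subsingleton.elim _ _
    simp [sierpinskiGraph, ← h]
  | succ n ih =>
    obtain ⟨b, v, rfl⟩ : ∃ b u, v = Fin.cons b u := ⟨v 0, Fin.tail v, (Fin.cons_self_tail v).symm⟩
    have key : ∀ c : Fin m, (∑ w : Fin n → Fin m,
        if (sierpinskiGraph (n + 1) m).Adj (Fin.cons b v) (Fin.cons c w) then 1 else 0) +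
        (if (Fin.cons b v : Fin (n + 1) → Fin m) = corner (n + 1) c then 1 else 0) =
        (if b = c then ∑ w, if (sierpinskiGraph n m).Adj v w then 1 else 0 else 0) +
        if v = corner n c then 1 else 0 := by
      intro c
      by_cases h : b = c
      · subst h
        simp [sierpinskiGraph_adj_cons, cons_eq_corner]
      · by_cases hv : v = corner n c <;> simp [sierpinskiGraph_adj_cons, cons_eq_corner, h, hv]
    rw [sum_cons, ← Finset.sum_add_distrib, Finset.sum_congr rfl fun c _ => key c,
      Finset.sum_add_distrib]
    simpa using ih v

open Classical in
theorem ncard_edgeBoundary {V : Type*} [Fintype V] (G : SimpleGraph V) (S : Finset V) :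
    (edgeBoundary G S).ncard = ∑ v, ∑ w, if v ∈ S ∧ w ∉ S ∧ G.Adj v w then 1 else 0 := by
  let P : Finset (V × V) := Finset.univ.filter fun p => p.1 ∈ S ∧ p.2 ∉ S ∧ G.Adj p.1 p.2
  have h : edgeBoundary G S = (fun p : V × V => s(p.1, p.2)) '' (P : Set (V × V)) := by
    ext e
    constructor
    · rintro ⟨he, v, w, rfl, hv, hw⟩
      exact ⟨(v, w), by simpa [P, hv, hw] using he, rfl⟩
    · rintro ⟨⟨v, w⟩, hp, rfl⟩
      have hp' : v ∈ S ∧ w ∉ S ∧ G.Adj v w := by simpa [P] using hp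
      exact ⟨hp'.2.2, v, w, rfl, hp'.1, hp'.2.1⟩
  rw [h, Set.InjOn.ncard_image, Set.ncard_coe_finset, Finset.card_filter,
    Fintype.sum_prod_type]
  rintro ⟨v, w⟩ hp ⟨v', w'⟩ hp' heq
  have h1 : v ∈ S ∧ w ∉ S ∧ G.Adj v w := by simpa [P] using hp
  have h2 : v' ∈ S ∧ w' ∉ S ∧ G.Adj v' w' := by simpa [P] using hp'
  rcases Sym2.eq_iff.1 heq with ⟨rfl, rfl⟩ | ⟨rfl, rfl⟩
  · rfl
  · exact absurd h1.1 h2.2.1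

/-- Counting edge ends at `S`: a boundary edge has one end in `S`, a spanned edge two, and a
pendant edge at a corner in `S` one. -/
theorem ncard_edgeBoundary_add {n m : ℕ} (S : Finset (Fin n → Fin m)) :
    (edgeBoundary (sierpinskiGraph n m) S).ncard + adjPairs (sierpinskiGraph n m) S +
      (Finset.univ.filter fun c : Fin m => corner n c ∈ S).card = m * S.card := by
  classical
  have h : ∑ v ∈ S, ((∑ w, if (sierpinskiGraph n m).Adj v w then 1 else 0) +
      (∑ c : Fin m, if v = corner n c then 1 else 0)) = m * S.card := by
    rw [Finset.sum_congr rfl fun v _ => degree_add_corners v]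
    simp [mul_comm]
  rw [← h, Finset.sum_add_distrib, ncard_edgeBoundary, adjPairs, ← Finset.sum_add_distrib]
  congr 1
  · trans ∑ v, if v ∈ S then ∑ w, if (sierpinskiGraph n m).Adj v w then 1 else 0 else 0
    · refine Finset.sum_congr rfl fun v _ => ?_
      rw [← Finset.sum_add_distrib]
      by_cases hv : v ∈ S
      · rw [if_pos hv]
        refine Finset.sum_congr rfl fun w _ => ?_
        by_cases hw : w ∈ S <;> simp [hv, hw]
      · simp [hv]
    · simp
  · rw [Finset.sum_comm, Finset.card_filter]
    refine Finset.sum_congr rfl fun c _ => ?_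
    simp

theorem mainTheorem1 (n m : ℕ) :
    (∀ ℓ : ℕ, ℓ ≤ m ^ n →
      (lexInitial n m ℓ).card = ℓ ∧
      edgeProfile (sierpinskiGraph n m) ℓ =
        (edgeBoundary (sierpinskiGraph n m) (lexInitial n m ℓ)).ncard) ∧
    (∀ ℓ ℓ' : ℕ, ℓ ≤ ℓ' → ℓ' ≤ m ^ n → lexInitial n m ℓ ⊆ lexInitial n m ℓ') := by
  refine ⟨fun ℓ hℓ => ⟨card_lexInitial hℓ, le_antisymm (Nat.sInf_le ⟨_, card_lexInitial hℓ, rfl⟩)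
    (le_csInf ⟨_, _, card_lexInitial hℓ, rfl⟩ ?_)⟩,
    fun ℓ ℓ' h _ v hv => mem_lexInitial.2 ((mem_lexInitial.1 hv).trans h)⟩
  rintro k ⟨S, hS, rfl⟩
  rcases Nat.eq_zero_or_pos m with rfl | hm
  · have := ncard_edgeBoundary_add (lexInitial n 0 ℓ)
    omega
  have hL := ncard_edgeBoundary_add (lexInitial n m ℓ)
  have hLS := ncard_edgeBoundary_add S
  -- The sum of the bounds for no pendant edges and for pendant edges at all corners is the bound
  -- for `4 e(S) + 2 k(S)`, that is, twice the loss in `|Θ(S)|`.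
  have h0 := adjPairs_add_corners_le n m S ∅
  have h1 := adjPairs_add_corners_le n m S Finset.univ
  have hq : lexCorners m n ℓ ≤ m := (lexCorners_mono hm n hℓ).trans (lexCorners_pow hm n).le
  have hc : (Finset.univ.filter fun c : Fin m => corner n c ∈ lexInitial n m ℓ).card =
      lexCorners m n ℓ := by
    simp only [lexCorners_spec hm n hℓ]
    rw [Fin.card_filter_val_lt]
    omega
  rw [adjPairs_lexInitial hm n hℓ, card_lexInitial hℓ, hc] at hL
  rw [hS] at hLS h0 h1
  simp only [Finset.card_univ, Fintype.card_fin, min_eq_right hq, Finset.filter_empty,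
    Finset.card_empty] at h0 h1
  omega
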